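/- For $\mathbf u=(u_1,\dots,u_n,u_{n+1})\in S^n$ (the unit sphere of $\mathbb R^{n+1}$) write $u=(u_1,\dots,u_n)\in\mathbb R^n$, so that $\mathbf u=(u,u_{n+1})$, and put $$H_{\mathbf u}^+=\{x\in\mathbb R^n\mid \langle u,x\rangle\ge u_{n+1}\},\qquad H_{\mathbf u}^-=\{x\in\mathbb R^n\mid \langle u,x\rangle\le u_{n+1}\}.$$ For a nonempty compact set $X\subset\mathbb R^n$ let $\delta^*(u\mid X)=\max_{x\in X}\langle u,x\rangle$ and $\delta_*(u\mid X)=\min_{x\in X}\langle u,x\rangle$. Let $\mathrm{co}\,A$ denote the convex hull of $A$. Theorem. Let $A_1,\dots,A_n\subset\mathbb R^n$ be compact sets (not necessarily convex; for instance finite) such that each convex hull $\mathrm{co}\,A_i$ has nonempty interior. Then there exists a single $\mathbf u=(u,u_{n+1})\in S^n$ such that, for every $i=1,\dots,n$, both $A_i\cap H_{\mathbf u}^+$ and $A_i\cap H_{\mathbf u}^-$ are nonempty and $$\delta^*(u\mid (\mathrm{co}\,A_i)\cap H_{\mathbf u}^+)-\delta_*(u\mid (\mathrm{co}\,A_i)\cap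 H_{\mathbf u}^+)=\delta^*(u\mid (\mathrm{co}\,A_i)\cap H_{\mathbf u}^-)-\delta_*(u\mid (\mathrm{co}\,A_i)\cap H_{\mathbf u}^-).$$ -/

import Mathlib

/-- The first `n` coordinates `u` of `𝐮 = (u, u_{n+1}) ∈ ℝⁿ⁺¹`. -/
noncomputable def sphereDir {n : ℕ} (U : EuclideanSpace ℝ (Fin (n + 1))) :
    EuclideanSpace ℝ (Fin n) :=
  WithLp.toLp 2 (fun j : Fin n => U j.castSucc)

/-- The last coordinate `u_{n+1}` of `𝐮 = (u, u_{n+1}) ∈ ℝⁿ⁺¹`. -/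
def sphereOffset {n : ℕ} (U : EuclideanSpace ℝ (Fin (n + 1))) : ℝ :=
  U (Fin.last n)

/-- The closed half-space `H_𝐮⁺ = {x ∈ ℝⁿ | ⟨u, x⟩ ≥ u_{n+1}}`. -/
def halfSpacePos {n : ℕ} (U : EuclideanSpace ℝ (Fin (n + 1))) :
    Set (EuclideanSpace ℝ (Fin n)) :=
  {x | sphereOffset U ≤ inner ℝ (sphereDir U) x}

/-- The closed half-space `H_𝐮⁻ = {x ∈ ℝⁿ | ⟨u, x⟩ ≤ u_{n+1}}`. -/
def halfSpaceNeg {n : ℕ} (U : EuclideanSpace ℝ (Fin (n + 1))) :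
    Set (EuclideanSpace ℝ (Fin n)) :=
  {x | inner ℝ (sphereDir U) x ≤ sphereOffset U}

/-- The support function `δ^*(u | X)`: the maximum of `⟨u, x⟩` over `x ∈ X`. It is written as a
supremum, which is an attained maximum whenever `X` is nonempty and compact
(see `isGreatest_supportFun`). -/
noncomputable def supportFun {n : ℕ} (u : EuclideanSpace ℝ (Fin n))
    (X : Set (EuclideanSpace ℝ (Fin n))) : ℝ :=
  sSup ((fun x => inner ℝ u x) '' X)

/-- The infimum support function `δ_*(u | X)`: the minimum of `⟨u, x⟩` over `x ∈ X`. It is written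
as an infimum, which is an attained minimum whenever `X` is nonempty and compact
(see `isLeast_infSupportFun`). -/
noncomputable def infSupportFun {n : ℕ} (u : EuclideanSpace ℝ (Fin n))
    (X : Set (EuclideanSpace ℝ (Fin n))) : ℝ :=
  sInf ((fun x => inner ℝ u x) '' X)

theorem isGreatest_supportFun {n : ℕ} (u : EuclideanSpace ℝ (Fin n))
    {X : Set (EuclideanSpace ℝ (Fin n))} (hX : IsCompact X) (hne : X.Nonempty) :
    IsGreatest ((fun x => inner ℝ u x) '' X) (supportFun u X) :=
  (hX.image (by fun_prop)).isGreatest_sSup (hne.image _)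

theorem isLeast_infSupportFun {n : ℕ} (u : EuclideanSpace ℝ (Fin n))
    {X : Set (EuclideanSpace ℝ (Fin n))} (hX : IsCompact X) (hne : X.Nonempty) :
    IsLeast ((fun x => inner ℝ u x) '' X) (infSupportFun u X) :=
  (hX.image (by fun_prop)).isLeast_sInf (hne.image _)

/-! If the hyperplane `⟨u, x⟩ = t` has `t` midway between the minimum `m` and maximum `M` of `⟨u,
·⟩` on `A i`, the two parts of the hull project onto `[m, t]` and `[t, M]`, of equal length, and the
extreme points of `A i` lie on either side. So one needs `u ≠ 0` for which all the midpoints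
coincide. With `d + 1` sets in dimension `d + 1` these are `d` equations, continuous and odd in `u`,
so Borsuk–Ulam (`exists_ne_zero_odd_map_eq_zero`) gives `u`; normalising `(u, t)` ends the proof.

Borsuk–Ulam is proved by a parity argument in the style of Ky Fan. If the odd map had no nonzero
zero, label points by the index and sign of their first large coordinate; adjacent grid points never
get opposite labels. Hemispheres of each dimension are parametrised by triangulated cubes, and
simplices whose signs alternate along increasing indices are counted mod 2. By
`sum_altIndicator_erase` the count in a cube equals a count of boundary facets; antipodality of top
and bottom makes it independent of the dimension (`altCount_succ`). It is 1 for a point, yet 0 in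
dimension `d`, where `d + 1` vertices would need distinct indices among `d`. -/

/-! ### Alternating labelings -/

open Finset in
/-- Indicator (mod 2) that the labels `l i`, `i ∈ T`, have distinct first components and, listed by
increasing first component, alternating second components starting with `ε`. -/
def altIndicator {ι : Type*} (ε : ZMod 2) (l : ι → ℕ × ZMod 2) (T : Finset ι) : ZMod 2 :=
  open Classical in
  if Set.InjOn (fun i => (l i).1) T ∧
      ∀ i ∈ T, (l i).2 = ε + (#{j ∈ T | (l j).1 < (l i).1} : ℕ) then 1 else 0

theorem altIndicator_congr {ι : Type*} {ε : ZMod 2} {l l' : ι → ℕ × ZMod 2} {T : Finset ι}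
    (h : ∀ i ∈ T, l i = l' i) : altIndicator ε l T = altIndicator ε l' T := by
  classical
  unfold altIndicator
  refine if_congr (and_congr ?_ ?_) rfl rfl
  · exact Set.EqOn.injOn_iff fun i hi => by simp [h i hi]
  · refine forall₂_congr fun i hi => ?_
    rw [h i hi, Finset.filter_congr fun j hj => by rw [h j hj]]

theorem altIndicator_image {ι κ : Type*} [DecidableEq κ] {ε : ZMod 2} {l : κ → ℕ × ZMod 2}
    {T : Finset ι} {f : ι → κ} (hf : Set.InjOn f T) :
    altIndicator ε l (T.image f) = altIndicator ε (l ∘ f) T := by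
  classical
  unfold altIndicator
  refine if_congr (and_congr ?_ ?_) rfl rfl
  · rw [Finset.coe_image]
    exact ⟨fun h => h.comp hf (Set.mapsTo_image f _), fun h => Set.InjOn.image_of_comp h⟩
  · rw [Finset.forall_mem_image]
    refine forall₂_congr fun i hi => ?_
    rw [Finset.filter_image, Finset.card_image_of_injOn]
    · rfl
    · exact hf.mono fun j hj => (Finset.mem_filter.1 hj).1

theorem altIndicator_eq_zero_of_eq {ι : Type*} {ε : ZMod 2} {l : ι → ℕ × ZMod 2} {T : Finset ι}
    {i j : ι} (hi : i ∈ T) (hj : j ∈ T) (hij : i ≠ j) (h : (l i).1 = (l j).1) :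
    altIndicator ε l T = 0 :=
  if_neg fun H => hij (H.1 hi hj h)

/-- The label with the same first component and the opposite second component. -/
def negLabel (p : ℕ × ZMod 2) : ℕ × ZMod 2 := (p.1, p.2 + 1)

theorem altIndicator_negLabel {ι : Type*} {l : ι → ℕ × ZMod 2} {T : Finset ι} :
    altIndicator 0 (fun i => negLabel (l i)) T = altIndicator 1 l T := by
  classical
  unfold altIndicator negLabel
  refine if_congr (and_congr Iff.rfl ?_) rfl rfl
  refine forall₂_congr fun i _ => ?_
  generalize ((Finset.card _ : ℕ) : ZMod 2) = c
  change (l i).2 + 1 = 0 + c ↔ (l i).2 = 1 + c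
  generalize (l i).2 = s
  revert c s; decide

theorem altIndicator_insert {ι : Type*} [DecidableEq ι] {ε : ZMod 2} {l : ι → ℕ × ZMod 2}
    {T : Finset ι} {m : ι} (hm : m ∉ T) (hlt : ∀ j ∈ T, (l j).1 < (l m).1) :
    altIndicator ε l (insert m T) =
      altIndicator ε l T * if (l m).2 = ε + (T.card : ℕ) then 1 else 0 := by
  classical
  unfold altIndicator
  rw [mul_ite, mul_one, mul_zero, ← ite_and]
  refine if_congr ?_ rfl rfl
  have h1 : Set.InjOn (fun i => (l i).1) ↑(insert m T) ↔ Set.InjOn (fun i => (l i).1) T := by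
    rw [Finset.coe_insert, Set.injOn_insert (by simpa using hm)]
    refine and_iff_left ?_
    rintro ⟨j, hj, h⟩
    exact (hlt j hj).ne h
  have h2 : Finset.filter (fun j => (l j).1 < (l m).1) (insert m T) = T := by
    rw [Finset.filter_insert, if_neg (lt_irrefl _), Finset.filter_true_of_mem hlt]
  rw [h1, Finset.forall_mem_insert, h2, and_left_comm]
  refine and_congr_right fun _ => and_congr_right fun _ => forall₂_congr fun i hi => ?_
  rw [Finset.filter_insert, if_neg (hlt i hi).not_gt]

/-- The coboundary of the indicator of alternating labelings, when no two labels are opposite. -/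
theorem sum_altIndicator_erase {ι : Type*} [DecidableEq ι] (l : ι → ℕ × ZMod 2) (T : Finset ι)
    (hl : ∀ i ∈ T, ∀ j ∈ T, (l i).1 = (l j).1 → (l i).2 = (l j).2) :
    ∑ i ∈ T, altIndicator 0 l (T.erase i) = altIndicator 0 l T + altIndicator 1 l T := by
  classical
  induction T using Finset.induction_on_max_value (fun i => (l i).1) with
  | empty => simp [altIndicator]; decide
  | insert m T hm hle ih =>
    specialize ih fun i hi j hj => hl i (by simp [hi]) j (by simp [hj])
    -- If `m` is the strict maximum it comes last in the order, so the facets containing it factor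
    -- through facets of `T` and a parity condition on the sign of `m`.
    by_cases hlt : ∀ j ∈ T, (l j).1 < (l m).1
    · have key : ∀ i ∈ T, altIndicator 0 l ((insert m T).erase i) =
          altIndicator 0 l (T.erase i) * if (l m).2 = 0 + ((T.card - 1 : ℕ) : ZMod 2) then 1 else 0 := by
        intro i hi
        have hne : m ≠ i := fun h => hm (h ▸ hi)
        rw [Finset.erase_insert_of_ne hne, altIndicator_insert, Finset.card_erase_of_mem hi]
        · exact fun h => hm (Finset.mem_of_mem_erase h)
        · exact fun j hj => hlt j (Finset.mem_of_mem_erase hj)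
      rw [Finset.sum_insert hm, Finset.erase_insert hm, Finset.sum_congr rfl key, ← Finset.sum_mul,
        ih, altIndicator_insert hm hlt, altIndicator_insert hm hlt]
      -- Truncated subtraction makes `T.card - 1` have the wrong parity when `T` is empty.
      rcases T.eq_empty_or_nonempty with rfl | hT
      · have : ∀ s : ZMod 2, (1 : ZMod 2) + (1 + 1) * (if s = 0 then 1 else 0)
          = (if s = 0 then 1 else 0) + if s = 1 then 1 else 0 := by decide
        simpa [altIndicator] using this (l m).2
      · have : ((T.card - 1 : ℕ) : ZMod 2) = T.card + 1 := by
          obtain ⟨c, hc⟩ := Nat.exists_eq_add_one.2 hT.card_pos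
          rw [hc, Nat.add_sub_cancel]
          push_cast
          generalize (c : ZMod 2) = c
          revert c; decide
        rw [this]
        generalize altIndicator 0 l T = p
        generalize altIndicator 1 l T = q
        generalize (l m).2 = s
        generalize (T.card : ZMod 2) = c
        revert p q s c; decide
    · push Not at hlt
      obtain ⟨j, hj, hjm⟩ := hlt
      have hjm : (l j).1 = (l m).1 := le_antisymm (hle j hj) hjm
      have hne : j ≠ m := fun h => hm (h ▸ hj)
      have hmi : m ∈ insert m T := by simp
      have hji : j ∈ insert m T := by simp [hj]
      rw [altIndicator_eq_zero_of_eq hji hmi hne hjm, altIndicator_eq_zero_of_eq hji hmi hne hjm,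
        Finset.sum_eq_add_of_mem m j hmi hji hne.symm]
      -- A tie forces equal labels, so omitting `m` or omitting `j` gives the same indicator and the
      -- two cancel; every other facet keeps both and vanishes.
      · have hjm2 : l j = l m := Prod.ext hjm (hl j hji m hmi hjm)
        have hs : (insert m T).erase j = ((insert m T).erase m).image (Equiv.swap m j) := by
          ext i
          simp only [Finset.mem_erase, Finset.mem_image]
          constructor
          · rintro ⟨h1, h2⟩
            by_cases h : i = m
            · exact ⟨j, ⟨hne, hji⟩, by simp [h]⟩
            · exact ⟨i, ⟨h, h2⟩, Equiv.swap_apply_of_ne_of_ne h h1⟩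
          · rintro ⟨r, ⟨h1, h2⟩, rfl⟩
            by_cases h : r = j
            · subst h; simpa using hne.symm
            · rw [Equiv.swap_apply_of_ne_of_ne h1 h]; exact ⟨h, h2⟩
        rw [hs, altIndicator_image (Equiv.injective _).injOn]
        have : altIndicator 0 (l ∘ Equiv.swap m j) ((insert m T).erase m)
            = altIndicator 0 l ((insert m T).erase m) := by
          refine altIndicator_congr fun i _ => ?_
          simp only [Function.comp_apply, Equiv.swap_apply_def]
          split_ifs with h1 h2
          · rw [h1, hjm2]
          · rw [h2, hjm2]
          · rfl
        rw [this, CharTwo.add_self_eq_zero, add_zero]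
      · intro c _ hc
        exact altIndicator_eq_zero_of_eq (Finset.mem_erase.2 ⟨hc.2.symm, hji⟩)
          (Finset.mem_erase.2 ⟨hc.1.symm, hmi⟩) hne hjm

/-! ### Counting alternating simplices of the Freudenthal triangulation -/

open Equiv

/-- The `i`-th vertex of the simplex of the Freudenthal triangulation with lowest vertex `x` and
ranks of coordinates `σ`. -/
def kuhnVertex {k : ℕ} (x : Fin k → ℕ) (σ : Perm (Fin k)) (i : ℕ) : Fin k → ℕ :=
  fun c => x c + if (σ c : ℕ) < i then 1 else 0

/-- The number mod 2 of alternating simplices of the Freudenthal triangulation of `[0, N]ᵏ`. -/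
def altCount (N k : ℕ) (L : (Fin k → ℕ) → ℕ × ZMod 2) : ZMod 2 :=
  ∑ σ : Perm (Fin k), ∑ x : Fin k → Fin N,
    (altIndicator 0 (fun i => L (kuhnVertex (fun c => x c) σ i)) (Finset.range (k + 1)) +
      altIndicator 1 (fun i => L (kuhnVertex (fun c => x c) σ i)) (Finset.range (k + 1)))

theorem altCount_zero (N : ℕ) (L : (Fin 0 → ℕ) → ℕ × ZMod 2) : altCount N 0 L = 1 := by
  have : ∀ s : ZMod 2, ((if s = 0 then 1 else 0) + if s = 1 then 1 else 0 : ZMod 2) = 1 := by decide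
  simpa [altCount, altIndicator, Finset.filter_singleton] using this _

/-- The vertices shared by the two simplices adjacent along a translate of a facet: the coordinate
of rank `0` is fixed. -/
def kuhnFace {k : ℕ} (y : Fin k → ℕ) (σ : Perm (Fin k)) (i : ℕ) : Fin k → ℕ :=
  fun c => y c + if 0 < (σ c : ℕ) ∧ (σ c : ℕ) ≤ i then 1 else 0

theorem kuhnVertex_succ {k : ℕ} (x : Fin (k + 1) → ℕ) (σ : Perm (Fin (k + 1))) (i : ℕ) :
    kuhnVertex x σ (i + 1) =
      kuhnFace (Function.update x (σ.symm 0) (x (σ.symm 0) + 1)) σ i := by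
  funext c
  unfold kuhnVertex kuhnFace
  by_cases h : c = σ.symm 0
  · subst h; simp
  · have : σ c ≠ 0 := fun h' => h (by simp [← h'])
    have : 0 < (σ c : ℕ) := Nat.pos_of_ne_zero fun h' => this (Fin.ext h')
    simp [h, this]

/-- The rotation moves the step of rank 0 to the end. With `kuhnVertex_succ`, this identifies the
facet omitting the last vertex with the facet omitting the first vertex of the simplex on the other
side. -/
theorem kuhnVertex_rotate {k : ℕ} (x : Fin (k + 1) → ℕ) (σ : Perm (Fin (k + 1))) {i : ℕ}
    (hi : i ≤ k) : kuhnVertex x ((finRotate (k + 1))⁻¹ * σ) i = kuhnFace x σ i := by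
  funext c
  unfold kuhnVertex kuhnFace
  congr 1
  refine if_congr ?_ rfl rfl
  rw [Perm.mul_apply]
  obtain ⟨r, hr⟩ : ∃ r, finRotate (k + 1) r = σ c := ⟨_, Equiv.apply_symm_apply _ _⟩
  rw [← hr, show (finRotate (k + 1))⁻¹ (finRotate (k + 1) r) = r from Equiv.symm_apply_apply _ _]
  by_cases h : r = Fin.last k
  · subst h; rw [finRotate_last]; simpa using hi
  · rw [coe_finRotate_of_ne_last h]; omega

theorem kuhnVertex_swap {k : ℕ} (x : Fin (k + 1) → ℕ) (σ : Perm (Fin (k + 1))) {i j : ℕ}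
    (hi : i < k) (hj : j ≠ i + 1) :
    kuhnVertex x (swap ⟨i, by omega⟩ ⟨i + 1, by omega⟩ * σ) j = kuhnVertex x σ j := by
  funext c
  unfold kuhnVertex
  congr 1
  refine if_congr ?_ rfl rfl
  rw [Perm.mul_apply, swap_apply_def]
  split_ifs with h1 h2
  · rw [h1]; simp only; omega
  · rw [h2]; simp only; omega
  · rfl

/-- Swapping two consecutive steps moves only the vertex between them, so facets omitting an
intermediate vertex cancel in pairs. -/
theorem sum_perm_erase_interior {k i : ℕ} (hi : i < k) (L : (Fin (k + 1) → ℕ) → ℕ × ZMod 2)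
    (x : Fin (k + 1) → ℕ) :
    ∑ σ : Perm (Fin (k + 1)), altIndicator 0 (fun j => L (kuhnVertex x σ j))
      ((Finset.range (k + 2)).erase (i + 1)) = 0 := by
  refine Finset.sum_involution
    (fun σ _ => swap (⟨i, by omega⟩ : Fin (k + 1)) ⟨i + 1, by omega⟩ * σ) ?_ ?_ (by simp) (by simp)
  · intro σ _
    rw [CharTwo.add_eq_zero]
    refine altIndicator_congr fun j hj => ?_
    rw [kuhnVertex_swap x σ hi (Finset.ne_of_mem_erase hj)]
  · intro σ _ _ h
    rw [mul_eq_right, swap_eq_one_iff] at h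
    simp at h

/-- Mod 2 the sum along direction `p` telescopes, leaving the two opposite faces of the cube. -/
theorem sum_telescope_insertNth {k N : ℕ} (p : Fin (k + 1)) (f : (Fin (k + 1) → ℕ) → ZMod 2) :
    ∑ x : Fin (k + 1) → Fin N, (f (Function.update (fun c => (x c : ℕ)) p (x p + 1)) + f (fun c => x c))
      = ∑ y : Fin k → Fin N, (f (p.insertNth (α := fun _ => ℕ) N (fun c => (y c : ℕ))) +
          f (p.insertNth (α := fun _ => ℕ) 0 (fun c => (y c : ℕ)))) := by
  rw [← (Fin.insertNthEquiv (fun _ => Fin N) p).sum_comp, Fintype.sum_prod_type, Finset.sum_comm]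
  refine Finset.sum_congr rfl fun y _ => ?_
  have h : ∀ t : Fin N, (fun c => ((p.insertNth (α := fun _ => Fin N) t y c : Fin N) : ℕ)) =
      p.insertNth (α := fun _ => ℕ) (t : ℕ) (fun c => (y c : ℕ)) := by
    intro t
    refine Fin.eq_insertNth_iff.2 ⟨by simp, ?_⟩
    funext c
    simp [Fin.removeNth]
  have h2 : ∀ t : ℕ, Function.update (p.insertNth (α := fun _ => ℕ) t (fun c => (y c : ℕ))) p (t + 1)
      = p.insertNth (α := fun _ => ℕ) (t + 1) (fun c => (y c : ℕ)) := by
    intro t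
    refine Fin.eq_insertNth_iff.2 ⟨by simp, ?_⟩
    funext c
    simp [Fin.removeNth]
  simp only [Fin.insertNthEquiv_apply, h, Fin.insertNth_apply_same, h2]
  rw [Fin.sum_univ_eq_sum_range (fun t => f (p.insertNth (α := fun _ => ℕ) (t + 1) (fun c => (y c : ℕ)))
    + f (p.insertNth (α := fun _ => ℕ) t (fun c => (y c : ℕ))))]
  have := Finset.sum_range_sub (fun t => f (p.insertNth (α := fun _ => ℕ) t (fun c => (y c : ℕ)))) N
  simpa only [CharTwo.sub_eq_add] using this

/-- The vertices of a simplex reflected in the centre of the cube. -/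
theorem sub_kuhnVertex {k N : ℕ} (y : Fin k → Fin N) (e : Perm (Fin k)) {i : ℕ} (hi : i ≤ k) :
    (fun c => N - kuhnVertex (fun c => (y c : ℕ)) e i c) =
      kuhnVertex (fun c => ((y c).rev : ℕ)) (Fin.revPerm * e) (k - i) := by
  funext c
  have h1 := (y c).2
  have h2 := (e c).2
  simp only [kuhnVertex, Perm.mul_apply, Fin.revPerm_apply, Fin.val_rev]
  split_ifs <;> omega

theorem kuhnFace_eq_cons {k t : ℕ} (y : Fin k → ℕ) (e : Perm (Fin k)) (i : ℕ) :
    kuhnFace (Fin.cons t y : Fin (k + 1) → ℕ) (Perm.decomposeFin.symm (0, e)) i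
      = Fin.cons t (kuhnVertex y e i) := by
  funext c
  refine Fin.cases ?_ (fun c => ?_) c
  · simp [kuhnFace, Perm.decomposeFin_symm_apply_zero]
  · simp [kuhnFace, kuhnVertex, Perm.decomposeFin_symm_apply_succ]

/-- On a side face the label ignores coordinate 0, so the two vertices joined by the step in that
coordinate share a label. -/
theorem altIndicator_kuhnFace_eq_zero {k N : ℕ} (L : (Fin (k + 1) → ℕ) → ℕ × ZMod 2)
    (hdeg : ∀ (v : Fin k → ℕ) (a b : ℕ), (∃ c, v c = 0 ∨ v c = N) →
      L (Fin.cons a v) = L (Fin.cons b v))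
    (σ : Perm (Fin (k + 1))) (hσ : σ 0 ≠ 0) (y : Fin (k + 1) → ℕ)
    (hy : y (σ.symm 0) = 0 ∨ y (σ.symm 0) = N) :
    altIndicator 0 (fun i => L (kuhnFace y σ i)) (Finset.range (k + 1)) = 0 := by
  obtain ⟨c, hc⟩ := Fin.exists_succ_eq.2
    (show σ.symm 0 ≠ 0 from fun h => hσ (by rw [← h, Equiv.apply_symm_apply, h]))
  have hr : 0 < (σ 0 : ℕ) := Nat.pos_of_ne_zero fun h => hσ (Fin.ext h)
  have hr' := (σ 0).2
  refine altIndicator_eq_zero_of_eq (i := (σ 0 : ℕ) - 1) (j := (σ 0 : ℕ))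
    (Finset.mem_range.2 (by omega)) (Finset.mem_range.2 hr') (by omega) ?_
  have htail : Fin.tail (kuhnFace y σ ((σ 0 : ℕ) - 1)) = Fin.tail (kuhnFace y σ (σ 0 : ℕ)) := by
    funext d
    have : (σ d.succ : ℕ) ≠ σ 0 := fun h => Fin.succ_ne_zero d (σ.injective (Fin.ext h))
    simp only [Fin.tail, kuhnFace]
    congr 1
    refine if_congr ?_ rfl rfl
    omega
  have := hdeg (Fin.tail (kuhnFace y σ (σ 0 : ℕ))) (kuhnFace y σ ((σ 0 : ℕ) - 1) 0)
    (kuhnFace y σ (σ 0 : ℕ) 0) ⟨c, by simpa [Fin.tail, kuhnFace, hc] using hy⟩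
  rw [Fin.cons_self_tail] at this
  rw [← this, ← htail, Fin.cons_self_tail]

/-- The number mod 2 of alternating simplices does not depend on the dimension. -/
theorem altCount_succ {k N : ℕ} (L : (Fin k → ℕ) → ℕ × ZMod 2)
    (L' : (Fin (k + 1) → ℕ) → ℕ × ZMod 2)
    (h0 : ∀ v, (∀ c, v c ≤ N) → L' (Fin.cons 0 v) = L v)
    (h1 : ∀ v, (∀ c, v c ≤ N) → L' (Fin.cons N v) = negLabel (L fun c => N - v c))
    (hdeg : ∀ (v : Fin k → ℕ) (a b : ℕ), (∃ c, v c = 0 ∨ v c = N) →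
      L' (Fin.cons a v) = L' (Fin.cons b v))
    (hcompl : ∀ v w : Fin (k + 1) → ℕ, (∀ c, v c ≤ N) → (∀ c, w c ≤ N) →
      (∀ c, v c ≤ w c + 1 ∧ w c ≤ v c + 1) → (L' v).1 = (L' w).1 → (L' v).2 = (L' w).2) :
    altCount N (k + 1) L' = altCount N k L := by
  have hle : ∀ {m : ℕ} (x : Fin m → Fin N) (σ : Perm (Fin m)) (i : ℕ) (c : Fin m),
      kuhnVertex (fun c => (x c : ℕ)) σ i c ≤ N := by
    intro m x σ i c
    have := (x c).2
    simp only [kuhnVertex]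
    split_ifs <;> omega
  let Γ : Perm (Fin (k + 1)) → (Fin (k + 1) → ℕ) → ZMod 2 := fun σ y =>
    altIndicator 0 (fun i => L' (kuhnFace y σ i)) (Finset.range (k + 1))
  have step1 : altCount N (k + 1) L' = ∑ σ : Perm (Fin (k + 1)), ∑ x : Fin (k + 1) → Fin N,
      (Γ σ (Function.update (fun c => (x c : ℕ)) (σ.symm 0) (x (σ.symm 0) + 1))
        + Γ σ (fun c => x c)) := by
    have fan : altCount N (k + 1) L' = ∑ σ : Perm (Fin (k + 1)), ∑ x : Fin (k + 1) → Fin N,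
        ∑ i ∈ Finset.range (k + 2), altIndicator 0
          (fun j => L' (kuhnVertex (fun c => x c) σ j)) ((Finset.range (k + 2)).erase i) := by
      refine Finset.sum_congr rfl fun σ _ => Finset.sum_congr rfl fun x _ => ?_
      refine (sum_altIndicator_erase _ _ fun i _ j _ => hcompl _ _ (hle _ _ _) (hle _ _ _) ?_).symm
      intro c
      simp only [kuhnVertex]
      split_ifs <;> omega
    have first : ∀ (σ : Perm (Fin (k + 1))) (x : Fin (k + 1) → Fin N),
        altIndicator 0 (fun j => L' (kuhnVertex (fun c => x c) σ j)) ((Finset.range (k + 2)).erase 0)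
          = Γ σ (Function.update (fun c => (x c : ℕ)) (σ.symm 0) (x (σ.symm 0) + 1)) := by
      intro σ x
      have : (Finset.range (k + 2)).erase 0 = (Finset.range (k + 1)).image Nat.succ := by
        ext i; cases i <;> simp
      rw [this, altIndicator_image Nat.succ_injective.injOn]
      refine altIndicator_congr fun i _ => ?_
      simp only [Function.comp_apply, Nat.succ_eq_add_one, kuhnVertex_succ]
    have last : ∑ σ : Perm (Fin (k + 1)), ∑ x : Fin (k + 1) → Fin N,
        altIndicator 0 (fun j => L' (kuhnVertex (fun c => x c) σ j))
          ((Finset.range (k + 2)).erase (k + 1)) =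
        ∑ σ : Perm (Fin (k + 1)), ∑ x : Fin (k + 1) → Fin N, Γ σ (fun c => x c) := by
      rw [← Equiv.sum_comp (Equiv.mulLeft ((finRotate (k + 1))⁻¹))]
      refine Finset.sum_congr rfl fun σ _ => Finset.sum_congr rfl fun x _ => ?_
      rw [Finset.range_add_one (n := k + 1), Finset.erase_insert (by simp)]
      refine altIndicator_congr fun i hi => ?_
      rw [Equiv.coe_mulLeft, kuhnVertex_rotate _ _ (Nat.lt_succ_iff.1 (Finset.mem_range.1 hi))]
    rw [fan]
    simp only [Finset.sum_range_succ' _ (k + 1), Finset.sum_range_succ _ k, Finset.sum_add_distrib,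
      first, last]
    have int : ∑ σ : Perm (Fin (k + 1)), ∑ x : Fin (k + 1) → Fin N, ∑ i ∈ Finset.range k,
        altIndicator 0 (fun j => L' (kuhnVertex (fun c => x c) σ j))
          ((Finset.range (k + 2)).erase (i + 1)) = 0 := by
      rw [Finset.sum_comm]
      refine Finset.sum_eq_zero fun x _ => ?_
      rw [Finset.sum_comm]
      exact Finset.sum_eq_zero fun i hi => sum_perm_erase_interior (Finset.mem_range.1 hi) L' _
    rw [int, zero_add, add_comm]
  rw [step1]
  simp only [sum_telescope_insertNth]
  have step2 : ∀ σ : Perm (Fin (k + 1)), σ 0 ≠ 0 → ∑ y : Fin k → Fin N,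
      (Γ σ ((σ.symm 0).insertNth (α := fun _ => ℕ) N (fun c => (y c : ℕ))) +
        Γ σ ((σ.symm 0).insertNth (α := fun _ => ℕ) 0 (fun c => (y c : ℕ)))) = 0 := by
    intro σ hσ
    refine Finset.sum_eq_zero fun y _ => ?_
    simp only [Γ]
    rw [altIndicator_kuhnFace_eq_zero L' hdeg σ hσ _ (by simp),
      altIndicator_kuhnFace_eq_zero L' hdeg σ hσ _ (by simp), add_zero]
  -- Only the permutations with `σ 0 = 0` remain: their facets triangulate the bottom and top faces.
  rw [← Perm.decomposeFin.symm.sum_comp, Fintype.sum_prod_type, Finset.sum_eq_single 0]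
  · have hsymm : ∀ e : Perm (Fin k), (Perm.decomposeFin.symm ((0 : Fin (k + 1)), e)).symm 0 = 0 := by
      intro e
      rw [Equiv.symm_apply_eq, Perm.decomposeFin_symm_apply_zero]
    simp only [hsymm, Fin.insertNth_zero']
    unfold altCount
    simp only [Finset.sum_add_distrib]
    rw [add_comm]
    congr 1
    · refine Finset.sum_congr rfl fun e _ => Finset.sum_congr rfl fun y _ => ?_
      refine altIndicator_congr fun i _ => ?_
      rw [kuhnFace_eq_cons, h0 _ (hle _ _ _)]
    -- Reflection in the centre permutes the simplices of the cube. On the top face it combines with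
    -- the sign change to turn alternation starting with 0 into alternation starting with 1.
    · rw [← Equiv.sum_comp (Equiv.mulLeft (Fin.revPerm : Perm (Fin k)))
        (fun σ => ∑ x : Fin k → Fin N, altIndicator 1
          (fun i => L (kuhnVertex (fun c => x c) σ i)) (Finset.range (k + 1)))]
      refine Finset.sum_congr rfl fun e _ => ?_
      rw [← (Equiv.arrowCongr (Equiv.refl (Fin k)) (Fin.revPerm (n := N))).sum_comp
        (fun x : Fin k → Fin N => altIndicator 1
          (fun i => L (kuhnVertex (fun c => x c) _ i)) (Finset.range (k + 1)))]
      refine Finset.sum_congr rfl fun y _ => ?_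
      have himg : Finset.range (k + 1) = (Finset.range (k + 1)).image (fun i => k - i) := by
        ext i
        simp only [Finset.mem_range, Finset.mem_image]
        exact ⟨fun h => ⟨k - i, by omega, by omega⟩, by rintro ⟨j, h, rfl⟩; omega⟩
      rw [himg, altIndicator_image, ← altIndicator_negLabel]
      · refine altIndicator_congr fun i hi => ?_
        rw [kuhnFace_eq_cons, h1 _ (hle _ _ _),
          sub_kuhnVertex _ _ (Nat.lt_succ_iff.1 (Finset.mem_range.1 hi))]
        rfl
      · intro i hi j hj h
        simp only [Finset.coe_range, Set.mem_Iio] at hi hj h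
        omega
  · intro p _ hp
    refine Finset.sum_eq_zero fun e _ => step2 _ ?_
    rwa [Perm.decomposeFin_symm_apply_zero]
  · simp


/-! ### Hemispheres parametrised by cubes -/

/-- A map from the cube `[0, 1]ᵏ` onto a hemisphere (up to scaling) of the first `k + 1` coordinates. -/
def hemisphereMap : (k : ℕ) → (Fin k → ℝ) → ℕ → ℝ
  | 0, _ => Pi.single 0 1
  | k + 1, v => Function.update
      (Function.update (hemisphereMap k (Fin.tail v)) k (hemisphereMap k (Fin.tail v) k * (1 - 2 * v 0)))
      (k + 1) (hemisphereMap k (Fin.tail v) k * (v 0 * (1 - v 0)))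

theorem hemisphereMap_succ_cons (k : ℕ) (t : ℝ) (v : Fin k → ℝ) :
    hemisphereMap (k + 1) (Fin.cons t v) = Function.update
      (Function.update (hemisphereMap k v) k (hemisphereMap k v k * (1 - 2 * t)))
      (k + 1) (hemisphereMap k v k * (t * (1 - t))) := by
  simp [hemisphereMap]

theorem hemisphereMap_of_lt {k : ℕ} (v : Fin k → ℝ) {j : ℕ} (hj : k < j) :
    hemisphereMap k v j = 0 := by
  induction k with
  | zero => simp [hemisphereMap, hj.ne']
  | succ k ih => rw [hemisphereMap, Function.update_of_ne (by omega),
      Function.update_of_ne (by omega), ih _ (by omega)]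

theorem continuous_hemisphereMap (k : ℕ) : Continuous (hemisphereMap k) := by
  induction k with
  | zero => exact continuous_const
  | succ k ih =>
    have h : Continuous fun v : Fin (k + 1) → ℝ => hemisphereMap k (Fin.tail v) :=
      ih.comp (continuous_pi fun i => continuous_apply _)
    have h' : Continuous fun v : Fin (k + 1) → ℝ => hemisphereMap k (Fin.tail v) k :=
      (continuous_apply k).comp h
    exact (h.update k (h'.mul (by fun_prop))).update (k + 1) (h'.mul (by fun_prop))

theorem exists_hemisphereMap_ne_zero {k : ℕ} (v : Fin k → ℝ) : ∃ j ≤ k, hemisphereMap k v j ≠ 0 := by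
  induction k with
  | zero => exact ⟨0, le_rfl, by simp [hemisphereMap]⟩
  | succ k ih =>
    obtain ⟨j, hj, h⟩ := ih (Fin.tail v)
    rcases hj.lt_or_eq with hlt | rfl
    · refine ⟨j, by omega, ?_⟩
      rwa [hemisphereMap, Function.update_of_ne (by omega), Function.update_of_ne (by omega)]
    · by_cases ht : 1 - 2 * v 0 = 0
      · refine ⟨j + 1, le_rfl, ?_⟩
        have : v 0 = 1 / 2 := by linarith
        rw [hemisphereMap, Function.update_self, this]
        exact mul_ne_zero h (by norm_num)
      · refine ⟨j, by omega, ?_⟩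
        rw [hemisphereMap, Function.update_of_ne (by omega), Function.update_self]
        exact mul_ne_zero h ht

theorem hemisphereMap_cons_zero {k : ℕ} (v : Fin k → ℝ) :
    hemisphereMap (k + 1) (Fin.cons 0 v) = hemisphereMap k v := by
  rw [hemisphereMap_succ_cons]
  simp only [mul_zero, sub_zero, mul_one, Function.update_eq_self]
  rw [← hemisphereMap_of_lt v (Nat.lt_succ_self k), Function.update_eq_self]

/-- Under `t ↦ 1 - t` the factor `1 - 2 * t` is odd and `t * (1 - t)` is even. This makes the top
face antipodal to the reflected bottom face in `hemisphereMap_cons_one`. -/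
theorem hemisphereMap_one_sub {k : ℕ} (v : Fin k → ℝ) (j : ℕ) :
    hemisphereMap k (fun c => 1 - v c) j = if j = k then hemisphereMap k v j
      else -hemisphereMap k v j := by
  induction k generalizing j with
  | zero =>
    split_ifs with h
    · rfl
    · simp [hemisphereMap, h]
  | succ k ih =>
    have ht : Fin.tail (fun c => 1 - v c) = fun c => 1 - Fin.tail v c := rfl
    have hk := ih (Fin.tail v) k
    rw [if_pos rfl] at hk
    rw [hemisphereMap, hemisphereMap, ht, hk]
    by_cases h1 : j = k + 1
    · subst h1
      simp only [Function.update_self, if_true]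
      ring
    · rw [if_neg h1, Function.update_of_ne h1, Function.update_of_ne h1]
      by_cases h2 : j = k
      · subst h2
        simp only [Function.update_self]
        ring
      · rw [Function.update_of_ne h2, Function.update_of_ne h2, ih, if_neg h2]

theorem hemisphereMap_cons_one {k : ℕ} (v : Fin k → ℝ) :
    hemisphereMap (k + 1) (Fin.cons 1 v) = -hemisphereMap k (fun c => 1 - v c) := by
  funext j
  rw [hemisphereMap_succ_cons, Pi.neg_apply, hemisphereMap_one_sub]
  by_cases h1 : j = k + 1
  · subst h1
    rw [Function.update_self, if_neg (by omega), hemisphereMap_of_lt v (Nat.lt_succ_self k)]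
    ring
  · rw [Function.update_of_ne h1]
    by_cases h2 : j = k
    · subst h2
      simp only [Function.update_self, if_true]
      ring
    · rw [Function.update_of_ne h2, if_neg h2, neg_neg]

/-- The last coordinate is the product of all the `v c * (1 - v c)`. -/
theorem hemisphereMap_apply_eq_zero {k : ℕ} (v : Fin k → ℝ) (h : ∃ c, v c = 0 ∨ v c = 1) :
    hemisphereMap k v k = 0 := by
  induction k with
  | zero => exact h.choose.elim0
  | succ k ih =>
    obtain ⟨c, hc⟩ := h
    rw [hemisphereMap, Function.update_self]
    induction c using Fin.cases with
    | zero => rcases hc with hc | hc <;> simp [hc]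
    | succ c => rw [ih (Fin.tail v) ⟨c, hc⟩, zero_mul]

theorem hemisphereMap_cons_of_degenerate {k : ℕ} (v : Fin k → ℝ) (h : ∃ c, v c = 0 ∨ v c = 1)
    (s t : ℝ) : hemisphereMap (k + 1) (Fin.cons s v) = hemisphereMap (k + 1) (Fin.cons t v) := by
  simp only [hemisphereMap_succ_cons, hemisphereMap_apply_eq_zero v h, zero_mul]

/-! ### The Borsuk–Ulam theorem -/

/-- **Borsuk–Ulam theorem**: an odd continuous map `ℝ^(d+1) → ℝ^d` vanishes at a nonzero vector. -/
theorem exists_ne_zero_odd_map_eq_zero {d : ℕ}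
    (g : EuclideanSpace ℝ (Fin (d + 1)) → Fin d → ℝ) (hg : Continuous g)
    (hodd : ∀ u, g (-u) = -g u) : ∃ u ≠ 0, g u = 0 := by
  classical
  by_contra! hne
  let proj : (ℕ → ℝ) → EuclideanSpace ℝ (Fin (d + 1)) := fun x => WithLp.toLp 2 fun j => x j
  have hproj : Continuous proj := by fun_prop
  let G : (ℕ → ℝ) → Fin d → ℝ := fun x => g (proj x)
  have hGodd : ∀ x, G (-x) = -G x := fun x => hodd (proj x)
  let cube : Set (Fin d → ℝ) := Set.Icc 0 1
  have hcube : IsCompact cube := isCompact_Icc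
  have hcont : Continuous fun v => G (hemisphereMap d v) :=
    hg.comp (hproj.comp (continuous_hemisphereMap d))
  have hG0 : ∀ v, G (hemisphereMap d v) ≠ 0 := by
    intro v
    refine hne _ fun h => ?_
    obtain ⟨j, hj, hv⟩ := exists_hemisphereMap_ne_zero v
    exact hv (congrArg (fun u : EuclideanSpace ℝ (Fin (d + 1)) => u ⟨j, by omega⟩) h)
  obtain ⟨ε, hε, hGε⟩ : ∃ ε > 0, ∀ v ∈ cube, ε ≤ ‖G (hemisphereMap d v)‖ := by
    obtain ⟨v, -, hv⟩ := hcube.exists_isMinOn ⟨0, by simp [cube]⟩ hcont.norm.continuousOn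
    exact ⟨_, norm_pos_iff.2 (hG0 v), fun w hw => hv hw⟩
  -- Opposite labels with the same index would force a gap of at least `2 * ε`, so a mesh below `δ`
  -- excludes them on neighbouring grid points.
  obtain ⟨δ, hδ, hGδ⟩ := Metric.uniformContinuousOn_iff.1
    (hcube.uniformContinuousOn_of_continuous hcont.continuousOn) ε hε
  obtain ⟨N, hN⟩ := exists_nat_one_div_lt hδ
  set M : ℕ := N + 1 with hM
  have hM0 : (M : ℝ) ≠ 0 := by positivity
  have hM0' : (0 : ℝ) < M := by positivity
  let Large : (ℕ → ℝ) → ℕ → Prop := fun x j => ∃ h : j < d, ε ≤ |G x ⟨j, h⟩|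
  -- The default `(0, 0)` is never met at grid points, by `hgood`.
  let lab : (ℕ → ℝ) → ℕ × ZMod 2 := fun x =>
    if h : ∃ j, Large x j then
      (Nat.find h, if 0 < G x ⟨Nat.find h, (Nat.find_spec h).choose⟩ then 1 else 0)
    else (0, 0)
  have hlab : ∀ x, (∃ j, Large x j) → ∃ j : Fin d, lab x = ((j : ℕ), if 0 < G x j then 1 else 0) ∧
      ε ≤ |G x j| ∧ ∀ i < j, |G x i| < ε := by
    intro x h
    refine ⟨⟨Nat.find h, (Nat.find_spec h).choose⟩, ?_, (Nat.find_spec h).choose_spec, ?_⟩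
    · simp only [lab, dif_pos h]
    · intro i hi
      by_contra! hc
      exact Nat.find_min h hi ⟨i.2, hc⟩
  have hneg : ∀ x, (∃ j, Large x j) → lab (-x) = negLabel (lab x) := by
    intro x h
    have habs : ∀ j, |G (-x) j| = |G x j| := fun j => by rw [hGodd, Pi.neg_apply, abs_neg]
    have h' : ∃ j, Large (-x) j := by
      obtain ⟨j, hj, hx⟩ := h
      exact ⟨j, hj, by rwa [habs]⟩
    obtain ⟨i, hi, hi1, hi2⟩ := hlab x h
    obtain ⟨j, hj, hj1, hj2⟩ := hlab _ h'
    simp only [habs] at hj1 hj2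
    obtain rfl : i = j := by
      rcases lt_trichotomy i j with hlt | heq | hgt
      · exact absurd hi1 (hj2 i hlt).not_ge
      · exact heq
      · exact absurd hj1 (hi2 j hgt).not_ge
    rw [hi, hj, hGodd, Pi.neg_apply, negLabel]
    have h0 : G x i ≠ 0 := fun h0 => by rw [h0, abs_zero] at hi1; linarith
    refine Prod.ext rfl ?_
    rcases h0.lt_or_gt with hlt | hgt
    · simp [hlt, hlt.not_gt]
    · simp [hgt, hgt.not_gt]; decide
  let pt : (k : ℕ) → (Fin k → ℕ) → ℕ → ℝ := fun k v => hemisphereMap k fun c => (v c : ℝ) / M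
  have hcons : ∀ {k : ℕ} (a : ℕ) (v : Fin k → ℕ),
      (fun c => ((Fin.cons a v : Fin (k + 1) → ℕ) c : ℝ) / M) =
        (Fin.cons ((a : ℝ) / M) fun c => (v c : ℝ) / M : Fin (k + 1) → ℝ) := by
    intro k a v
    funext c
    refine Fin.cases ?_ (fun c => ?_) c <;> simp
  have hpt0 : ∀ {k : ℕ} (v : Fin k → ℕ), pt (k + 1) (Fin.cons 0 v) = pt k v := by
    intro k v
    simp only [pt, hcons, Nat.cast_zero, zero_div, hemisphereMap_cons_zero]
  have hmem : ∀ v : Fin d → ℕ, (∀ c, v c ≤ M) → (fun c => (v c : ℝ) / M) ∈ cube := by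
    intro v hv
    refine ⟨fun c => by simp only [Pi.zero_apply]; positivity, fun c => ?_⟩
    rw [Pi.one_apply, div_le_one hM0']
    exact_mod_cast hv c
  have hgood : ∀ k ≤ d, ∀ v : Fin k → ℕ, (∀ c, v c ≤ M) → ∃ j, Large (pt k v) j := by
    intro k hk
    -- The `k`-cube is the bottom face of the `(k + 1)`-cube, with the same points of the
    -- hemisphere, so the case `d` implies the lower ones.
    induction hk using Nat.decreasingInduction with
    | self =>
      intro v hv
      by_contra! h
      refine (hGε _ (hmem v hv)).not_gt ((pi_norm_lt_iff hε).2 fun j => ?_)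
      by_contra! hj
      exact h j ⟨j.2, hj⟩
    | of_succ k hk ih =>
      intro v hv
      rw [← hpt0]
      exact ih _ fun c => Fin.cases (by simp) hv c
  have hcompl : ∀ k ≤ d, ∀ v w : Fin k → ℕ, (∀ c, v c ≤ M) → (∀ c, w c ≤ M) →
      (∀ c, v c ≤ w c + 1 ∧ w c ≤ v c + 1) → (lab (pt k v)).1 = (lab (pt k w)).1 →
      (lab (pt k v)).2 = (lab (pt k w)).2 := by
    intro k hk
    induction hk using Nat.decreasingInduction with
    | self =>
      intro v w hv hw hvw heq
      obtain ⟨i, hi, hi1, -⟩ := hlab _ (hgood d le_rfl v hv)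
      obtain ⟨j, hj, hj1, -⟩ := hlab _ (hgood d le_rfl w hw)
      rw [hi, hj] at heq ⊢
      obtain rfl : i = j := Fin.ext heq
      have hdist : dist (fun c => (v c : ℝ) / M) (fun c => (w c : ℝ) / M) < δ := by
        refine lt_of_le_of_lt ((dist_pi_le_iff (by positivity)).2 fun c => ?_) hN
        rw [Real.dist_eq, ← sub_div, abs_div, abs_of_pos hM0', hM]
        push_cast
        refine div_le_div_of_nonneg_right ?_ (by positivity)
        rw [abs_le]
        have h1 : (v c : ℝ) ≤ w c + 1 := by exact_mod_cast (hvw c).1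
        have h2 : (w c : ℝ) ≤ v c + 1 := by exact_mod_cast (hvw c).2
        constructor <;> linarith
      have hd := (dist_le_pi_dist _ _ i).trans_lt (hGδ _ (hmem v hv) _ (hmem w hw) hdist)
      rw [Real.dist_eq, abs_lt] at hd
      refine if_congr ?_ rfl rfl
      change ε ≤ |G (hemisphereMap d _) i| at hi1 hj1
      change 0 < G (hemisphereMap d _) i ↔ 0 < G (hemisphereMap d _) i
      rw [le_abs] at hi1 hj1
      constructor <;> intro <;> rcases hi1 with hi1 | hi1 <;> rcases hj1 with hj1 | hj1 <;> linarith
    | of_succ k hk ih =>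
      intro v w hv hw hvw heq
      rw [← hpt0 v, ← hpt0 w] at heq ⊢
      exact ih _ _ (fun c => Fin.cases (by simp) hv c) (fun c => Fin.cases (by simp) hw c)
        (fun c => Fin.cases (by simp) hvw c) heq
  have hcount : ∀ k ≤ d, altCount M k (fun v => lab (pt k v)) = 1 := by
    intro k
    induction k with
    | zero => exact fun _ => altCount_zero _ _
    | succ k ih =>
      intro hk
      rw [← ih (by omega)]
      refine altCount_succ _ _ ?_ ?_ ?_ (hcompl _ hk)
      · exact fun v _ => by rw [hpt0]
      · intro v hv
        rw [← hneg _ (hgood k (by omega) _ fun c => Nat.sub_le _ _)]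
        congr 1
        simp only [pt, hcons, div_self hM0, hemisphereMap_cons_one]
        congr 2
        funext c
        rw [Nat.cast_sub (hv c), sub_div, div_self hM0]
      · rintro v a b ⟨c, hc⟩
        simp only [pt, hcons]
        rw [hemisphereMap_cons_of_degenerate _ ⟨c, ?_⟩]
        rcases hc with hc | hc
        · left; simp [hc]
        · right; rw [hc, div_self hM0]
  -- Pigeonhole: `d + 1` vertices, but only `d` possible indices.
  have hzero : ∀ (ε : ZMod 2) (v : ℕ → Fin d → ℕ), (∀ i c, v i c ≤ M) →
      altIndicator ε (fun i => lab (pt d (v i))) (Finset.range (d + 1)) = 0 := by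
    intro ε v hv
    refine if_neg fun H => ?_
    have hmaps : ∀ i ∈ Finset.range (d + 1), (lab (pt d (v i))).1 ∈ Finset.range d := by
      intro i _
      obtain ⟨j, hj, -⟩ := hlab _ (hgood d le_rfl (v i) (hv i))
      rw [hj]
      exact Finset.mem_range.2 j.2
    have := Finset.card_le_card_of_injOn _ hmaps H.1
    simp at this
  have h := hcount d le_rfl
  unfold altCount at h
  rw [Finset.sum_eq_zero] at h
  · exact zero_ne_one h
  · refine fun σ _ => Finset.sum_eq_zero fun x _ => ?_
    have hle : ∀ i c, kuhnVertex (fun c => (x c : ℕ)) σ i c ≤ M := by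
      intro i c
      have := (x c).2
      simp only [kuhnVertex]
      split_ifs <;> omega
    rw [hzero 0 _ hle, hzero 1 _ hle, add_zero]

/-! ### Support functions and midpoint hyperplanes -/

open scoped Pointwise

theorem infSupportFun_neg {n : ℕ} (u : EuclideanSpace ℝ (Fin n))
    (X : Set (EuclideanSpace ℝ (Fin n))) : infSupportFun (-u) X = -supportFun u X := by
  have : (fun x => inner ℝ (-u) x) '' X = -((fun x => inner ℝ u x) '' X) := by
    rw [← Set.image_neg_eq_neg, Set.image_image]
    simp only [inner_neg_left]
  rw [infSupportFun, this, Real.sInf_def, neg_neg, supportFun]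

theorem supportFun_neg {n : ℕ} (u : EuclideanSpace ℝ (Fin n))
    (X : Set (EuclideanSpace ℝ (Fin n))) : supportFun (-u) X = -infSupportFun u X := by
  have := infSupportFun_neg (-u) X
  rw [neg_neg] at this
  rw [this, neg_neg]

theorem image_inner_smul {n : ℕ} (r : ℝ) (u : EuclideanSpace ℝ (Fin n))
    (X : Set (EuclideanSpace ℝ (Fin n))) :
    (fun x => inner ℝ (r • u) x) '' X = r • ((fun x => inner ℝ u x) '' X) := by
  rw [← Set.image_smul, Set.image_image]
  simp only [real_inner_smul_left, smul_eq_mul]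

theorem supportFun_smul {n : ℕ} {r : ℝ} (hr : 0 ≤ r) (u : EuclideanSpace ℝ (Fin n))
    (X : Set (EuclideanSpace ℝ (Fin n))) : supportFun (r • u) X = r * supportFun u X := by
  rw [supportFun, image_inner_smul, Real.sSup_smul_of_nonneg hr]; rfl

theorem infSupportFun_smul {n : ℕ} {r : ℝ} (hr : 0 ≤ r) (u : EuclideanSpace ℝ (Fin n))
    (X : Set (EuclideanSpace ℝ (Fin n))) : infSupportFun (r • u) X = r * infSupportFun u X := by
  rw [infSupportFun, image_inner_smul, Real.sInf_smul_of_nonneg hr]; rfl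

theorem continuous_supportFun {n : ℕ} {X : Set (EuclideanSpace ℝ (Fin n))} (hX : IsCompact X) :
    Continuous fun u => supportFun u X :=
  hX.continuous_sSup (f := fun u x => inner ℝ u x) (by fun_prop)

theorem continuous_infSupportFun {n : ℕ} {X : Set (EuclideanSpace ℝ (Fin n))} (hX : IsCompact X) :
    Continuous fun u => infSupportFun u X :=
  hX.continuous_sInf (f := fun u x => inner ℝ u x) (by fun_prop)

/-- A linear functional commutes with convex hulls, and on the line the hull is the segment between
the attained extremes. Hence `X` need not be convex. -/
theorem image_inner_convexHull {n : ℕ} (u : EuclideanSpace ℝ (Fin n))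
    {X : Set (EuclideanSpace ℝ (Fin n))} (hX : IsCompact X) (hne : X.Nonempty) :
    (fun x => inner ℝ u x) '' (convexHull ℝ X) = Set.Icc (infSupportFun u X) (supportFun u X) := by
  have himg : (fun x => inner ℝ u x) '' (convexHull ℝ X)
      = convexHull ℝ ((fun x => inner ℝ u x) '' X) :=
    (innerₛₗ ℝ u).image_convexHull X
  have hmax := isGreatest_supportFun u hX hne
  have hmin := isLeast_infSupportFun u hX hne
  rw [himg]
  refine Set.Subset.antisymm (convexHull_min (fun y hy => ⟨hmin.2 hy, hmax.2 hy⟩)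
    (convex_Icc _ _)) ?_
  rw [← segment_eq_Icc (hmin.2 hmax.1)]
  exact segment_subset_convexHull hmin.1 hmax.1

/-- The hyperplane through the midpoint of the projection of `X` halves the width of its convex
hull. -/
theorem halfSpace_widths_eq {n : ℕ} (U : EuclideanSpace ℝ (Fin (n + 1)))
    {X : Set (EuclideanSpace ℝ (Fin n))} (hX : IsCompact X) (hne : X.Nonempty)
    (hU : 2 * sphereOffset U = supportFun (sphereDir U) X + infSupportFun (sphereDir U) X) :
    (X ∩ halfSpacePos U).Nonempty ∧ (X ∩ halfSpaceNeg U).Nonempty ∧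
      supportFun (sphereDir U) (convexHull ℝ X ∩ halfSpacePos U)
          - infSupportFun (sphereDir U) (convexHull ℝ X ∩ halfSpacePos U)
        = supportFun (sphereDir U) (convexHull ℝ X ∩ halfSpaceNeg U)
          - infSupportFun (sphereDir U) (convexHull ℝ X ∩ halfSpaceNeg U) := by
  have hmax := isGreatest_supportFun (sphereDir U) hX hne
  have hmin := isLeast_infSupportFun (sphereDir U) hX hne
  have himg := image_inner_convexHull (sphereDir U) hX hne
  have hle := hmin.2 hmax.1
  set M := supportFun (sphereDir U) X
  set m := infSupportFun (sphereDir U) X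
  set t := sphereOffset U with ht
  have hmt : m ≤ t := by linarith
  have htM : t ≤ M := by linarith
  have hpos : (fun x => inner ℝ (sphereDir U) x) '' (convexHull ℝ X ∩ halfSpacePos U)
      = Set.Icc t M := by
    rw [show halfSpacePos U = (fun x => inner ℝ (sphereDir U) x) ⁻¹' Set.Ici t from rfl,
      Set.image_inter_preimage, himg]
    ext y
    simp only [Set.mem_inter_iff, Set.mem_Icc, Set.mem_Ici]
    exact ⟨fun h => ⟨h.2, h.1.2⟩, fun h => ⟨⟨hmt.trans h.1, h.2⟩, h.1⟩⟩
  have hneg : (fun x => inner ℝ (sphereDir U) x) '' (convexHull ℝ X ∩ halfSpaceNeg U)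
      = Set.Icc m t := by
    rw [show halfSpaceNeg U = (fun x => inner ℝ (sphereDir U) x) ⁻¹' Set.Iic t from rfl,
      Set.image_inter_preimage, himg]
    ext y
    simp only [Set.mem_inter_iff, Set.mem_Icc, Set.mem_Iic]
    exact ⟨fun h => ⟨h.1.1, h.2⟩, fun h => ⟨⟨h.1, h.2.trans htM⟩, h.2⟩⟩
  refine ⟨?_, ?_, ?_⟩
  · obtain ⟨x, hx, hxM⟩ := hmax.1
    exact ⟨x, hx, htM.trans_eq hxM.symm⟩
  · obtain ⟨x, hx, hxm⟩ := hmin.1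
    exact ⟨x, hx, hxm.trans_le hmt⟩
  · simp only [supportFun, infSupportFun, hpos, hneg]
    rw [csSup_Icc htM, csInf_Icc htM, csSup_Icc hmt, csInf_Icc hmt]
    linarith


/-- A common midpoint hyperplane of `d + 1` compact sets in `ℝ^(d+1)`. -/
theorem exists_common_midpoint {d : ℕ} (A : Fin (d + 1) → Set (EuclideanSpace ℝ (Fin (d + 1))))
    (hA : ∀ i, IsCompact (A i)) :
    ∃ u ≠ 0, ∃ t : ℝ, ∀ i, 2 * t = supportFun u (A i) + infSupportFun u (A i) := by
  -- Each doubled midpoint is odd, since `u ↦ -u` exchanges maximum and minimum up to sign;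
  -- comparing all with the last one leaves `d` equations.
  obtain ⟨u, hu, h⟩ := exists_ne_zero_odd_map_eq_zero
    (fun u (j : Fin d) => (supportFun u (A j.castSucc) + infSupportFun u (A j.castSucc)) -
      (supportFun u (A (Fin.last d)) + infSupportFun u (A (Fin.last d))))
    (continuous_pi fun j =>
      ((continuous_supportFun (hA _)).add (continuous_infSupportFun (hA _))).sub
        ((continuous_supportFun (hA _)).add (continuous_infSupportFun (hA _))))
    (fun u => by
      funext j
      simp only [supportFun_neg, infSupportFun_neg, Pi.neg_apply]
      ring)
  refine ⟨u, hu, (supportFun u (A (Fin.last d)) + infSupportFun u (A (Fin.last d))) / 2,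
    fun i => ?_⟩
  rw [mul_div_cancel₀ _ two_ne_zero]
  induction i using Fin.lastCases with
  | last => rfl
  | cast j => exact (sub_eq_zero.1 (congrFun h j)).symm

theorem mainTheorem4 (n : ℕ) (A : Fin n → Set (EuclideanSpace ℝ (Fin n)))
    (hA : ∀ i, IsCompact (A i))
    (hint : ∀ i, (interior (convexHull ℝ (A i))).Nonempty) :
    ∃ U ∈ Metric.sphere (0 : EuclideanSpace ℝ (Fin (n + 1))) 1, ∀ i,
      (A i ∩ halfSpacePos U).Nonempty ∧ (A i ∩ halfSpaceNeg U).Nonempty ∧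
      supportFun (sphereDir U) (convexHull ℝ (A i) ∩ halfSpacePos U)
          - infSupportFun (sphereDir U) (convexHull ℝ (A i) ∩ halfSpacePos U)
        = supportFun (sphereDir U) (convexHull ℝ (A i) ∩ halfSpaceNeg U)
          - infSupportFun (sphereDir U) (convexHull ℝ (A i) ∩ halfSpaceNeg U) := by
  have hne : ∀ i, (A i).Nonempty := fun i =>
    convexHull_nonempty_iff.1 ((hint i).mono interior_subset)
  rcases n with _ | d
  · exact ⟨EuclideanSpace.single 0 1, by simp, fun i => i.elim0⟩
  obtain ⟨u, hu, t, h⟩ := exists_common_midpoint A hA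
  let V : EuclideanSpace ℝ (Fin (d + 1 + 1)) := WithLp.toLp 2 (Fin.snoc (fun j => u j) t)
  have hVu : sphereDir V = u := by ext j; simp [sphereDir, V]
  have hVt : sphereOffset V = t := by simp [sphereOffset, V]
  have hV : V ≠ 0 := by
    intro h0
    refine hu ?_
    rw [← hVu, h0]
    ext j
    simp [sphereDir]
  have hdir : sphereDir (‖V‖⁻¹ • V) = ‖V‖⁻¹ • u := by rw [← hVu]; ext j; simp [sphereDir]
  have hoff : sphereOffset (‖V‖⁻¹ • V) = ‖V‖⁻¹ * t := by rw [← hVt]; simp [sphereOffset]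
  refine ⟨‖V‖⁻¹ • V, ?_, fun i => halfSpace_widths_eq _ (hA i) (hne i) ?_⟩
  · rw [mem_sphere_zero_iff_norm, norm_smul, norm_inv, norm_norm,
      inv_mul_cancel₀ (norm_ne_zero_iff.2 hV)]
  · have hr : 0 ≤ ‖V‖⁻¹ := by positivity
    -- The midpoint equation is positively homogeneous in `(u, t)`, so it survives normalisation.
    rw [hdir, hoff, supportFun_smul hr, infSupportFun_smul hr, ← mul_add, ← h i]
    ring
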